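/- Let $n\ge 0$ and $M\ge 4$ be integers, let $A_1,\dots,A_M\subset\mathbb{R}^n$ be arbitrary sets, let $A=\bigcup_{m=1}^M A_m$, and let $\langle\cdot,\cdot\rangle$ and $\|\cdot\|$ be the Euclidean inner product and norm on $\mathbb{R}^n$. Let $\epsilon=(\epsilon_1,\dots,\epsilon_n)$ be a vector of independent Rademacher variables, that is, each $\epsilon_i$ is uniformly distributed on $\{-1,1\}$. Then $$\mathbb{E}\sup_{z\in A}\langle\epsilon,z\rangle\;\le\;\max_{1\le m\le M}\mathbb{E}\sup_{z\in A_m}\langle\epsilon,z\rangle\;+\;4\,\sup_{z\in A}\|z\|\,\sqrt{\ln M}.$$ If instead $\epsilon_1,\dots,\epsilon_n$ are independent standard normal variables, then $$\mathbb{E}\sup_{z\in A}\langle\epsilon,z\rangle\;\le\;\max_{1\le m\le M}\mathbb{E}\sup_{z\in A_m}\langle\epsilon,z\rangle\;+\;2\,\sup_{z\in A}\|z\|\,\sqrt{\ln M}.$$ Suprema and expectations are taken in the extended real numbers $[-\infty,\infty]$, with $\sup\emptyset=-\infty$. -/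

import Mathlib

open MeasureTheory ProbabilityTheory
open scoped ENNReal

noncomputable section

/-- The Rademacher distribution: the uniform probability distribution on `{-1, 1}`. -/
def rademacher : Measure ℝ :=
  (2⁻¹ : ℝ≥0∞) • Measure.dirac (-1) + (2⁻¹ : ℝ≥0∞) • Measure.dirac 1

/-- The expectation `E[X] = E[X⁺] - E[X⁻]` of an extended-real-valued random variable.
It is the usual one whenever `E[X⁺]` and `E[X⁻]` are not both infinite. -/
def expect {Ω : Type*} [MeasurableSpace Ω] (P : Measure Ω) (X : Ω → EReal) : EReal :=
  ((∫⁻ ω, (X ω).toENNReal ∂P : ℝ≥0∞) : EReal) -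
    ((∫⁻ ω, (-X ω).toENNReal ∂P : ℝ≥0∞) : EReal)

/-- `sup_{z ∈ A} ⟨x, z⟩`, as an extended real number (`-∞` for the empty set). -/
def supInner {n : ℕ} (A : Set (EuclideanSpace ℝ (Fin n))) (x : Fin n → ℝ) : EReal :=
  ⨆ z ∈ A, ((inner ℝ (WithLp.toLp 2 x) z : ℝ) : EReal)

/-- `sup_{z ∈ A} ‖z‖` for the Euclidean norm, as an extended real number (`-∞` for the empty set). -/
def supNorm {n : ℕ} (A : Set (EuclideanSpace ℝ (Fin n))) : EReal :=
  ⨆ z ∈ A, ((‖z‖ : ℝ) : EReal)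

/-- On integrable real random variables, `expect` is the Bochner integral. -/
theorem expect_coe {Ω : Type*} [MeasurableSpace Ω] (P : Measure Ω) (f : Ω → ℝ)
    (hf : Integrable f P) :
    expect P (fun ω => (f ω : EReal)) = ((∫ ω, f ω ∂P : ℝ) : EReal) := by
  rw [integral_eq_lintegral_pos_part_sub_lintegral_neg_part hf, EReal.coe_sub]
  have h1 : ∫⁻ ω, ENNReal.ofReal (f ω) ∂P ≠ ⊤ := hf.lintegral_lt_top.ne
  have h2 : ∫⁻ ω, ENNReal.ofReal (-f ω) ∂P ≠ ⊤ := hf.neg.lintegral_lt_top.ne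
  rw [EReal.coe_ennreal_toReal h1, EReal.coe_ennreal_toReal h2]
  simp only [expect, ← EReal.coe_neg, EReal.real_coe_toENNReal]

end

/-! The core is concentration in product form: `E e^F * E e^(-F) ≤ e^(c² K²)` for convex
`K`-Lipschitz `F` of the random vector, with `c = 2` for signs and `c = 1` for Gaussians. By Jensen
the second factor is at least `e^(-E F)`, so the centred exponential moment is bounded without
identifying a median or proving tail bounds. The support function of a nonempty set in the ball of
radius `L` is convex and `L`-Lipschitz. Summing exponential moments over at most `M` pieces gives `t
* (E Y - a) ≤ log M + (t c L)²` for all `t > 0`, where `Y` is the supremum over the union and `a`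
the largest mean over a piece; optimising `t` gives the term `2 c L √(log M)`
(`integral_le_add_two_mul_sqrt_log`).

The product form comes from Maurey's infimum convolution: if `u x ≤ f y + cost (x - y)` for all
admissible `x`, `y`, then `E e^u * E e^(-f) ≤ 1`. A Lipschitz `F` satisfies the premise with `f = F`
and `u = F` minus a multiple of `K²`. On the cube (`cube_infConv`) the cost is `|x - y|² / 16`, `f`
is convex and `y` ranges over the solid cube; induction on dimension reduces to a two-point
inequality. For Gaussians (`gaussian_pi_infConv`) the cost is `|x - y|² / 4`; the one-dimensional
case is Prékopa-Leindler, and it tensorises by Fubini. -/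

/-! ### Operations preserving convexity -/

/-- The partial infimum of a jointly convex function is convex. -/
theorem convexOn_iInf_of_prod {E F : Type*} [AddCommGroup E] [Module ℝ E] [AddCommGroup F]
    [Module ℝ F] {S : Set E} {T : Set F} (hS : Convex ℝ S) (hT : T.Nonempty) {φ : E × F → ℝ}
    (hφ : ConvexOn ℝ (S ×ˢ T) φ) {C : ℝ} (hC : ∀ p ∈ S ×ˢ T, C ≤ φ p) :
    ConvexOn ℝ S (fun s => ⨅ y : T, φ (s, y)) := by
  have : Nonempty T := hT.to_subtype
  have hbdd : ∀ s ∈ S, BddBelow (Set.range fun y : T => φ (s, y)) := by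
    rintro s hs
    exact ⟨C, by rintro _ ⟨y, rfl⟩; exact hC _ ⟨hs, y.2⟩⟩
  -- The infima need not be attained, so near-minimisers are combined and `δ` is sent to zero.
  refine ⟨hS, fun s hs t ht a b ha hb hab => le_of_forall_pos_le_add fun δ hδ => ?_⟩
  obtain ⟨y, hy⟩ := exists_lt_of_ciInf_lt
    (show (⨅ y : T, φ (s, y)) < (⨅ y : T, φ (s, y)) + δ by linarith)
  obtain ⟨z, hz⟩ := exists_lt_of_ciInf_lt
    (show (⨅ y : T, φ (t, y)) < (⨅ y : T, φ (t, y)) + δ by linarith)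
  have hst := hφ.1 (show (s, (y : F)) ∈ S ×ˢ T from ⟨hs, y.2⟩)
    (show (t, (z : F)) ∈ S ×ˢ T from ⟨ht, z.2⟩) ha hb hab
  have h1 := hφ.2 (show (s, (y : F)) ∈ S ×ˢ T from ⟨hs, y.2⟩)
    (show (t, (z : F)) ∈ S ×ˢ T from ⟨ht, z.2⟩) ha hb hab
  have h2 : (⨅ w : T, φ (a • s + b • t, w)) ≤ φ (a • s + b • t, a • (y : F) + b • (z : F)) :=
    ciInf_le (hbdd _ hst.1) (⟨_, hst.2⟩ : T)
  refine h2.trans (h1.trans ?_)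
  simp only [smul_eq_mul]
  have h3 := mul_le_mul_of_nonneg_left hy.le ha
  have h4 := mul_le_mul_of_nonneg_left hz.le hb
  calc _ ≤ _ := add_le_add h3 h4
    _ = a * (⨅ y : T, φ (s, y)) + b * (⨅ y : T, φ (t, y)) + (a + b) * δ := by ring
    _ = _ := by rw [hab, one_mul]

/-- Log-sum-exp preserves convexity. -/
theorem convexOn_log_sum_exp {E ι : Type*} [AddCommGroup E] [Module ℝ E] [Fintype ι] [Nonempty ι]
    {S : Set E} (hS : Convex ℝ S) {k : ι → E → ℝ} (hk : ∀ i, ConvexOn ℝ S (k i)) :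
    ConvexOn ℝ S (fun s => Real.log (∑ i, Real.exp (k i s))) := by
  have hpos : ∀ s, 0 < ∑ i, Real.exp (k i s) := fun s =>
    Finset.sum_pos (fun i _ => Real.exp_pos _) Finset.univ_nonempty
  have hnorm : ∀ s, ∑ i, Real.exp (k i s - Real.log (∑ i, Real.exp (k i s))) = 1 := by
    intro s
    simp_rw [Real.exp_sub, Real.exp_log (hpos s), ← Finset.sum_div]
    exact div_self (hpos s).ne'
  refine ⟨hS, fun s hs t ht a b ha hb hab => ?_⟩
  set g := fun s => Real.log (∑ i, Real.exp (k i s)) with hg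
  rw [Real.log_le_iff_le_exp (hpos _)]
  -- After subtracting `g` the exponentials sum to one at `s` and at `t`, so convexity of `exp`,
  -- applied termwise, sums to `a + b = 1`.
  have h : ∀ i, Real.exp (k i (a • s + b • t)) ≤
      (a * Real.exp (k i s - g s) + b * Real.exp (k i t - g t)) *
        Real.exp (a • g s + b • g t) := by
    intro i
    have h1 := (hk i).2 hs ht ha hb hab
    have h2 := convexOn_exp.2 (Set.mem_univ (k i s - g s)) (Set.mem_univ (k i t - g t)) ha hb hab
    simp only [smul_eq_mul] at h1 h2 ⊢
    calc Real.exp (k i (a • s + b • t)) ≤ Real.exp (a * k i s + b * k i t) :=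
          Real.exp_le_exp.2 h1
      _ = Real.exp (a * (k i s - g s) + b * (k i t - g t)) * Real.exp (a * g s + b * g t) := by
          rw [← Real.exp_add]; congr 1; ring
      _ ≤ _ := mul_le_mul_of_nonneg_right h2 (Real.exp_pos _).le
  refine (Finset.sum_le_sum fun i _ => h i).trans (le_of_eq ?_)
  rw [← Finset.sum_mul, Finset.sum_add_distrib, ← Finset.mul_sum, ← Finset.mul_sum, hnorm, hnorm,
    mul_one, mul_one, hab, one_mul]

/-! ### The two-point inequality -/

/-- Second-order bounds on the exponentials of the expanded product leave at most `4 - 2a² + 8a⁴`,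
and `a ≤ 1/4` makes the quartic term harmless. -/
theorem exp_add_exp_mul_le_four_of_le {a : ℝ} (ha : 0 ≤ a) (ha' : a ≤ 1 / 4) :
    (Real.exp (a - 4 * a ^ 2) + Real.exp (-a)) * (Real.exp (-a) + Real.exp a) ≤ 4 := by
  have e1 : (Real.exp (a - 4 * a ^ 2) + Real.exp (-a)) * (Real.exp (-a) + Real.exp a) =
      Real.exp (-(4 * a ^ 2)) + Real.exp (2 * a - 4 * a ^ 2) + Real.exp (-(2 * a)) + 1 := by
    simp only [add_mul, mul_add, ← Real.exp_add]
    rw [show a - 4 * a ^ 2 + -a = -(4 * a ^ 2) by ring,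
      show a - 4 * a ^ 2 + a = 2 * a - 4 * a ^ 2 by ring, show -a + -a = -(2 * a) by ring,
      show -a + a = 0 by ring, Real.exp_zero]
    ring
  have hq : ∀ y : ℝ, |y| ≤ 1 → Real.exp y ≤ 1 + y + y ^ 2 := fun y hy => by
    have := (abs_le.1 (Real.abs_exp_sub_one_sub_id_le hy)).2
    linarith
  have hh : ∀ y : ℝ, 0 ≤ y → Real.exp (-y) ≤ 1 - y + y ^ 2 / 2 := fun y hy => by
    have h := Real.quadratic_le_exp_of_nonneg hy
    rw [Real.exp_neg, inv_le_iff_one_le_mul₀ (Real.exp_pos _)]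
    have h' : 0 ≤ 1 - y + y ^ 2 / 2 := by nlinarith [sq_nonneg (y - 1)]
    nlinarith [mul_le_mul_of_nonneg_left h h', sq_nonneg (y ^ 2)]
  have h1 := hh (4 * a ^ 2) (by positivity)
  have h2 := hh (2 * a) (by positivity)
  have h3 := hq (2 * a - 4 * a ^ 2) (abs_le.2 ⟨by nlinarith, by nlinarith⟩)
  have h4 : (2 * a - 4 * a ^ 2) ^ 2 ≤ (2 * a) ^ 2 :=
    pow_le_pow_left₀ (by nlinarith) (by nlinarith) 2
  rw [e1]
  have h5 : (a ^ 2) ^ 2 ≤ a ^ 2 * (1 / 16) := by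
    have : a ^ 2 ≤ 1 / 16 := by nlinarith
    nlinarith [sq_nonneg a]
  nlinarith [sq_nonneg a]

/-- The product factors as `(e^(1/4) + 1) * (e^(-2a) + 1)`, which is at most `(7/3) * (5/3) < 4`. -/
theorem exp_add_exp_mul_le_four_of_ge {a : ℝ} (ha : 1 / 4 ≤ a) :
    (Real.exp (1 / 4 - a) + Real.exp (-a)) * (Real.exp (-a) + Real.exp a) ≤ 4 := by
  have e1 : (Real.exp (1 / 4 - a) + Real.exp (-a)) * (Real.exp (-a) + Real.exp a) =
      (Real.exp (1 / 4) + 1) * (Real.exp (-(2 * a)) + 1) := by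
    simp only [add_mul, mul_add, ← Real.exp_add]
    rw [show 1 / 4 - a + -a = 1 / 4 + -(2 * a) by ring, show 1 / 4 - a + a = 1 / 4 by ring,
      show -a + -a = -(2 * a) by ring, show -a + a = 0 by ring, Real.exp_zero]
    ring
  have h1 : Real.exp (1 / 4) ≤ 4 / 3 := by
    have := Real.add_one_le_exp (-(1 / 4) : ℝ)
    rw [Real.exp_neg] at this
    have h := Real.exp_pos (1 / 4 : ℝ)
    rw [le_inv_comm₀ (by norm_num) h] at this
    norm_num at this ⊢
    exact this
  have h2 : Real.exp (-(2 * a)) ≤ 2 / 3 := by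
    have := Real.add_one_le_exp (2 * a)
    rw [Real.exp_neg, inv_le_comm₀ (Real.exp_pos _) (by norm_num)]
    linarith
  rw [e1]
  calc _ ≤ (4 / 3 + 1 : ℝ) * (2 / 3 + 1) := by gcongr
    _ ≤ 4 := by norm_num

/-- The one-dimensional infimum-convolution inequality on `{-1, 1}` for convex functions, when the
larger endpoint value is at `1`. -/
theorem two_point_infConv_of_le {g : ℝ → ℝ} (hg : ConvexOn ℝ (Set.Icc (-1) 1) g)
    (h01 : g (-1) ≤ g 1) {u v c d N : ℝ} (hc : 0 ≤ c) (hd : 0 ≤ d) (hN : 0 ≤ N)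
    (hu : ∀ t ∈ Set.Icc (-1 : ℝ) 1, u ≤ Real.exp (g t + (1 - t) ^ 2 / 16))
    (hv : v ≤ Real.exp (g (-1)))
    (hc' : c ≤ N * Real.exp (-g 1)) (hd' : d ≤ N * Real.exp (-g (-1))) :
    (u + v) * (c + d) ≤ 4 * N := by
  -- Midpoint and half-difference of the endpoint values; the factors `e^m` and `e^(-m)` cancel in
  -- the product.
  obtain ⟨m, a, h1, h0, ha⟩ : ∃ m a : ℝ, g 1 = m + a ∧ g (-1) = m - a ∧ 0 ≤ a :=
    ⟨(g 1 + g (-1)) / 2, (g 1 - g (-1)) / 2, by ring, by ring, by linarith⟩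
  have key : ∀ r : ℝ, u ≤ Real.exp m * Real.exp r →
      (Real.exp r + Real.exp (-a)) * (Real.exp (-a) + Real.exp a) ≤ 4 →
      (u + v) * (c + d) ≤ 4 * N := by
    intro r hur hr
    have hcd : c + d ≤ N * (Real.exp (-m) * (Real.exp (-a) + Real.exp a)) := by
      refine (add_le_add hc' hd').trans (le_of_eq ?_)
      rw [h1, h0, mul_add (Real.exp (-m)), ← Real.exp_add, ← Real.exp_add, ← mul_add]
      ring_nf
    have huv : u + v ≤ Real.exp m * (Real.exp r + Real.exp (-a)) := by
      rw [mul_add]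
      refine add_le_add hur (hv.trans (le_of_eq ?_))
      rw [h0, ← Real.exp_add, sub_eq_add_neg]
    calc (u + v) * (c + d) ≤ (Real.exp m * (Real.exp r + Real.exp (-a))) * (c + d) :=
          mul_le_mul_of_nonneg_right huv (by positivity)
      _ ≤ (Real.exp m * (Real.exp r + Real.exp (-a))) *
            (N * (Real.exp (-m) * (Real.exp (-a) + Real.exp a))) :=
          mul_le_mul_of_nonneg_left hcd (by positivity)
      _ = ((Real.exp r + Real.exp (-a)) * (Real.exp (-a) + Real.exp a)) * N *
            (Real.exp m * Real.exp (-m)) := by ring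
      _ = ((Real.exp r + Real.exp (-a)) * (Real.exp (-a) + Real.exp a)) * N := by
          rw [← Real.exp_add, add_neg_cancel, Real.exp_zero, mul_one]
      _ ≤ 4 * N := mul_le_mul_of_nonneg_right hr hN
  rcases le_total a (1 / 4) with h | h
  -- Below its chord, `g (1 - s) ≤ m + a - a * s`; adding the cost `s² / 16` gives a minimum at `s =
  -- 8a`, which stays in the interval exactly when `a ≤ 1/4`. Otherwise the endpoint `s = 2` is
  -- best.
  · refine key (a - 4 * a ^ 2) ?_ (exp_add_exp_mul_le_four_of_le ha h)
    refine (hu (1 - 8 * a) ⟨by linarith, by linarith⟩).trans ?_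
    rw [← Real.exp_add, Real.exp_le_exp]
    have := hg.2 (show (1 : ℝ) ∈ Set.Icc (-1 : ℝ) 1 by norm_num)
      (show (-1 : ℝ) ∈ Set.Icc (-1 : ℝ) 1 by norm_num) (show 0 ≤ 1 - 4 * a by linarith)
      (show 0 ≤ 4 * a by linarith) (by ring)
    simp only [smul_eq_mul] at this
    rw [show (1 - 4 * a) * 1 + 4 * a * -1 = 1 - 8 * a by ring, h1, h0] at this
    nlinarith
  · refine key (1 / 4 - a) ?_ (exp_add_exp_mul_le_four_of_ge h)
    refine (hu (-1) (by norm_num)).trans ?_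
    rw [← Real.exp_add, Real.exp_le_exp, h0]
    linarith

/-- The one-dimensional infimum-convolution inequality on `{-1, 1}` for convex functions. -/
theorem two_point_infConv {g : ℝ → ℝ} (hg : ConvexOn ℝ (Set.Icc (-1) 1) g)
    {u v c d N : ℝ} (hc : 0 ≤ c) (hd : 0 ≤ d) (hN : 0 ≤ N)
    (hu : ∀ t ∈ Set.Icc (-1 : ℝ) 1, u ≤ Real.exp (g t + (1 - t) ^ 2 / 16))
    (hv : ∀ t ∈ Set.Icc (-1 : ℝ) 1, v ≤ Real.exp (g t + (-1 - t) ^ 2 / 16))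
    (hc' : c ≤ N * Real.exp (-g 1)) (hd' : d ≤ N * Real.exp (-g (-1))) :
    (u + v) * (c + d) ≤ 4 * N := by
  rcases le_total (g (-1)) (g 1) with h | h
  · exact two_point_infConv_of_le hg h hc hd hN hu (by simpa using hv (-1) (by norm_num)) hc' hd'
  · have hneg : ConvexOn ℝ (Set.Icc (-1) 1) (fun t => g (-t)) := by
      refine ⟨convex_Icc _ _, fun s hs t ht a b ha hb hab => ?_⟩
      have := hg.2 (show -s ∈ Set.Icc (-1 : ℝ) 1 from ⟨by linarith [hs.2], by linarith [hs.1]⟩)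
        (show -t ∈ Set.Icc (-1 : ℝ) 1 from ⟨by linarith [ht.2], by linarith [ht.1]⟩) ha hb hab
      simp only [smul_eq_mul] at this ⊢
      convert this using 2
      ring
    have := two_point_infConv_of_le (g := fun t => g (-t)) hneg (by simpa using h) hd hc hN
      (u := v) (v := u)
      (fun t ht => by
        have := hv (-t) ⟨by linarith [ht.2], by linarith [ht.1]⟩
        rwa [show (-1 - -t) ^ 2 = (1 - t) ^ 2 by ring] at this)
      (by simpa using hu 1 (by norm_num)) (by simpa using hd') (by simpa using hc')
    linarith [this]

/-! ### Infimum convolution on the discrete cube -/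

/-- The embedding of a two-point set onto `{-1, 1}`. -/
def boolSign (b : Bool) : ℝ := cond b 1 (-1)

theorem sum_fin_succ_bool {β : Type*} [AddCommMonoid β] {n : ℕ} (f : (Fin (n + 1) → Bool) → β) :
    ∑ b, f b = ∑ x, f (Fin.cons true x) + ∑ x, f (Fin.cons false x) := by
  rw [← Equiv.sum_comp (Fin.consEquiv (fun _ : Fin (n + 1) => Bool)) f, Fintype.sum_prod_type,
    Fintype.sum_bool]
  rfl

theorem cons_mem_Icc {n : ℕ} {t : ℝ} {y : Fin n → ℝ} (ht : t ∈ Set.Icc (-1 : ℝ) 1)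
    (hy : y ∈ Set.Icc (-1 : Fin n → ℝ) 1) :
    (Fin.cons t y : Fin (n + 1) → ℝ) ∈ Set.Icc (-1 : Fin (n + 1) → ℝ) 1 :=
  ⟨fun i => Fin.cases (by simpa using ht.1) (fun j => by simpa using hy.1 j) i,
    fun i => Fin.cases (by simpa using ht.2) (fun j => by simpa using hy.2 j) i⟩

theorem cons_combo {n : ℕ} (a b s t : ℝ) (x y : Fin n → ℝ) :
    (Fin.cons (a • s + b • t) (a • x + b • y) : Fin (n + 1) → ℝ) =
      a • (Fin.cons s x : Fin (n + 1) → ℝ) + b • (Fin.cons t y : Fin (n + 1) → ℝ) := by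
  funext i
  refine Fin.cases ?_ (fun j => ?_) i <;> simp

theorem boolSign_comp_cons {n : ℕ} (c : Bool) (x : Fin n → Bool) :
    boolSign ∘ (Fin.cons c x : Fin (n + 1) → Bool) = Fin.cons (boolSign c) (boolSign ∘ x) := by
  funext i
  refine Fin.cases ?_ (fun j => ?_) i <;> simp

/-- The infimum-convolution inequality on the discrete cube for convex functions. -/
theorem cube_infConv (n : ℕ) : ∀ (f : (Fin n → ℝ) → ℝ) (C : ℝ),
    ConvexOn ℝ (Set.Icc (-1) 1) f → (∀ y ∈ Set.Icc (-1 : Fin n → ℝ) 1, C ≤ f y) →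
    ∀ u : (Fin n → Bool) → ℝ,
    (∀ b, ∀ y ∈ Set.Icc (-1 : Fin n → ℝ) 1, u b ≤ f y + ∑ i, (boolSign (b i) - y i) ^ 2 / 16) →
    (∑ b, Real.exp (u b)) * (∑ b : Fin n → Bool, Real.exp (-f (boolSign ∘ b))) ≤ 4 ^ n := by
  induction n with
  | zero =>
    intro f C _ _ u hu
    rw [Fintype.sum_unique, Fintype.sum_unique, ← Real.exp_add, pow_zero, Real.exp_le_one_iff]
    have h : ∀ x y, u x ≤ f y := fun x y => by
      simpa using hu x y ⟨fun i => i.elim0, fun i => i.elim0⟩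
    rw [← sub_eq_add_neg]
    exact sub_nonpos.2 (h _ _)
  | succ n ih =>
    intro f C hf hC u hu
    -- The cost on the last `n` coordinates only. Minimising over `y` gives `k x t`, convex in `t`;
    -- its log-sum-exp `g` is the convex function fed to the two-point inequality, with `N = 4 ^ n`
    -- from the induction hypothesis on each slice.
    set φ : (Fin n → Bool) → ℝ × (Fin n → ℝ) → ℝ := fun x p =>
      f (Fin.cons p.1 p.2) + ∑ i, (boolSign (x i) - p.2 i) ^ 2 / 16 with hφ
    have hφC : ∀ x, ∀ p ∈ Set.Icc (-1 : ℝ) 1 ×ˢ Set.Icc (-1 : Fin n → ℝ) 1, C ≤ φ x p := by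
      intro x p hp
      have h1 := hC _ (cons_mem_Icc hp.1 hp.2)
      have h2 : 0 ≤ ∑ i, (boolSign (x i) - p.2 i) ^ 2 / 16 :=
        Finset.sum_nonneg fun i _ => by positivity
      simp only [hφ]
      linarith
    have hφconv : ∀ x, ConvexOn ℝ (Set.Icc (-1 : ℝ) 1 ×ˢ Set.Icc (-1 : Fin n → ℝ) 1) (φ x) := by
      intro x
      refine ⟨(convex_Icc _ _).prod (convex_Icc _ _), fun p hp q hq a b ha hb hab => ?_⟩
      have h1 := hf.2 (cons_mem_Icc hp.1 hp.2) (cons_mem_Icc hq.1 hq.2) ha hb hab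
      rw [← cons_combo] at h1
      have h2 : ∑ i, (boolSign (x i) - (a • p + b • q).2 i) ^ 2 / 16 ≤
          a * ∑ i, (boolSign (x i) - p.2 i) ^ 2 / 16 +
            b * ∑ i, (boolSign (x i) - q.2 i) ^ 2 / 16 := by
        rw [Finset.mul_sum, Finset.mul_sum, ← Finset.sum_add_distrib]
        refine Finset.sum_le_sum fun i _ => ?_
        simp only [Prod.snd_add, Prod.smul_snd, Pi.add_apply, Pi.smul_apply, smul_eq_mul]
        obtain rfl : b = 1 - a := by linarith
        nlinarith [mul_nonneg (mul_nonneg ha hb) (sq_nonneg (p.2 i - q.2 i))]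
      simp only [hφ, smul_eq_mul, mul_add] at h1 ⊢
      simp only [Prod.fst_add, Prod.smul_fst, Prod.snd_add, Prod.smul_snd, smul_eq_mul] at h2 ⊢
      linarith
    have hne : (Set.Icc (-1 : Fin n → ℝ) 1).Nonempty :=
      Set.nonempty_Icc.2 fun i => by simp
    set k : (Fin n → Bool) → ℝ → ℝ := fun x t => ⨅ y : Set.Icc (-1 : Fin n → ℝ) 1, φ x (t, y)
      with hk
    have hkle : ∀ x, ∀ t ∈ Set.Icc (-1 : ℝ) 1, ∀ y ∈ Set.Icc (-1 : Fin n → ℝ) 1,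
        k x t ≤ φ x (t, y) := fun x t ht y hy =>
      ciInf_le (f := fun y : Set.Icc (-1 : Fin n → ℝ) 1 => φ x (t, y))
        ⟨C, by rintro _ ⟨z, rfl⟩; exact hφC x _ ⟨ht, z.2⟩⟩ ⟨y, hy⟩
    have hkconv : ∀ x, ConvexOn ℝ (Set.Icc (-1 : ℝ) 1) (k x) := fun x =>
      convexOn_iInf_of_prod (convex_Icc _ _) hne (hφconv x) (hφC x)
    have hg := convexOn_log_sum_exp (convex_Icc (-1 : ℝ) 1) hkconv
    set g : ℝ → ℝ := fun t => Real.log (∑ x, Real.exp (k x t)) with hgdef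
    have hGpos : ∀ t, 0 < ∑ x, Real.exp (k x t) := fun t =>
      Finset.sum_pos (fun i _ => Real.exp_pos _) Finset.univ_nonempty
    have hIH : ∀ t ∈ Set.Icc (-1 : ℝ) 1,
        ∑ x : Fin n → Bool, Real.exp (-f (Fin.cons t (boolSign ∘ x))) ≤
          4 ^ n * Real.exp (-g t) := by
      intro t ht
      have h := ih (fun y => f (Fin.cons t y)) C
        ⟨convex_Icc _ _, fun y hy z hz a b ha hb hab => by
          have := hf.2 (cons_mem_Icc ht hy) (cons_mem_Icc ht hz) ha hb hab
          rwa [← cons_combo, ← add_smul, hab, one_smul] at this⟩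
        (fun y hy => hC _ (cons_mem_Icc ht hy)) (fun x => k x t)
        (fun x y hy => hkle x t ht y hy)
      rw [Real.exp_neg, Real.exp_log (hGpos t), ← div_eq_mul_inv, le_div_iff₀ (hGpos t), mul_comm]
      exact h
    have hU : ∀ c : Bool, ∀ t ∈ Set.Icc (-1 : ℝ) 1, ∑ x, Real.exp (u (Fin.cons c x)) ≤
        Real.exp (g t + (boolSign c - t) ^ 2 / 16) := by
      intro c t ht
      rw [Real.exp_add, Real.exp_log (hGpos t), Finset.sum_mul]
      refine Finset.sum_le_sum fun x _ => ?_
      rw [← Real.exp_add, Real.exp_le_exp, ← sub_le_iff_le_add]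
      have : Nonempty (Set.Icc (-1 : Fin n → ℝ) 1) := hne.to_subtype
      refine le_ciInf fun y => ?_
      have := hu (Fin.cons c x) _ (cons_mem_Icc ht y.2)
      rw [Fin.sum_univ_succ] at this
      simp only [Fin.cons_zero, Fin.cons_succ] at this
      simp only [hφ]
      linarith
    rw [sum_fin_succ_bool, sum_fin_succ_bool]
    simp only [boolSign_comp_cons]
    have := two_point_infConv hg (Finset.sum_nonneg fun x _ => (Real.exp_pos _).le)
      (Finset.sum_nonneg fun x _ => (Real.exp_pos _).le) (by positivity)
      (fun t ht => by simpa [boolSign] using hU true t ht)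
      (fun t ht => by simpa [boolSign] using hU false t ht)
      (hIH 1 (by norm_num)) (hIH (-1) (by norm_num))
    rw [pow_succ']
    simpa [boolSign] using this

/-! ### Product measures and the Rademacher law -/

theorem piFinSuccAbove_zero_symm {n : ℕ} :
    ((MeasurableEquiv.piFinSuccAbove (fun _ : Fin (n + 1) => ℝ) 0).symm :
      ℝ × (Fin n → ℝ) → Fin (n + 1) → ℝ) = fun p => Fin.cons p.1 p.2 := by
  funext p
  exact Fin.insertNth_zero' p.1 p.2

theorem measurable_fin_cons {n : ℕ} :
    Measurable (fun p : ℝ × (Fin n → ℝ) => (Fin.cons p.1 p.2 : Fin (n + 1) → ℝ)) := by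
  rw [← piFinSuccAbove_zero_symm]
  exact MeasurableEquiv.measurable _

/-- Fubini's theorem for a power measure, splitting off the first coordinate. -/
theorem lintegral_pi_fin_succ {n : ℕ} (ν : Measure ℝ) [SigmaFinite ν]
    {f : (Fin (n + 1) → ℝ) → ℝ≥0∞} (hf : Measurable f) :
    ∫⁻ x, f x ∂Measure.pi (fun _ : Fin (n + 1) => ν) =
      ∫⁻ s, ∫⁻ x, f (Fin.cons s x) ∂Measure.pi (fun _ : Fin n => ν) ∂ν := by
  have h := (measurePreserving_piFinSuccAbove (fun _ : Fin (n + 1) => ν) 0).symm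
  rw [piFinSuccAbove_zero_symm] at h
  rw [← h.lintegral_comp hf]
  exact lintegral_prod _ (hf.comp measurable_fin_cons).aemeasurable

instance : IsProbabilityMeasure rademacher :=
  ⟨by simp [rademacher, ENNReal.inv_two_add_inv_two]⟩

theorem integrable_id_rademacher : Integrable id rademacher := by
  refine Integrable.add_measure ?_ ?_
  · exact (integrable_dirac (by simp)).smul_measure (by simp)
  · exact (integrable_dirac (by simp)).smul_measure (by simp)

theorem lintegral_rademacher {f : ℝ → ℝ≥0∞} (hf : Measurable f) :
    ∫⁻ x, f x ∂rademacher = 2⁻¹ * (f 1 + f (-1)) := by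
  rw [rademacher, lintegral_add_measure, lintegral_smul_measure, lintegral_smul_measure,
    lintegral_dirac' _ hf, lintegral_dirac' _ hf, smul_eq_mul, smul_eq_mul, mul_add, add_comm]

theorem lintegral_pi_rademacher (n : ℕ) : ∀ {f : (Fin n → ℝ) → ℝ≥0∞}, Measurable f →
    ∫⁻ x, f x ∂Measure.pi (fun _ : Fin n => rademacher) =
      2⁻¹ ^ n * ∑ b : Fin n → Bool, f (boolSign ∘ b) := by
  induction n with
  | zero =>
    intro f hf
    rw [Measure.pi_of_empty _ default, lintegral_dirac' _ hf, Fintype.sum_unique, pow_zero,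
      one_mul]
    congr 1
    exact Subsingleton.elim _ _
  | succ n ih =>
    intro f hf
    have hm : ∀ s : ℝ, Measurable fun x : Fin n → ℝ => f (Fin.cons s x) := fun s =>
      hf.comp (measurable_fin_cons.comp measurable_prodMk_left)
    have hm' : Measurable fun s : ℝ =>
        ∫⁻ x, f (Fin.cons s x) ∂Measure.pi (fun _ : Fin n => rademacher) :=
      Measurable.lintegral_prod_right' (hf.comp measurable_fin_cons)
    rw [lintegral_pi_fin_succ _ hf, lintegral_rademacher hm',
      ih (hm 1), ih (hm (-1)), sum_fin_succ_bool]
    simp only [boolSign_comp_cons]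
    rw [pow_succ', ← mul_add, mul_assoc]
    rfl

/-! ### Concentration for Rademacher variables -/

theorem LipschitzWith.measurable_comp_toLp {n : ℕ} {F : EuclideanSpace ℝ (Fin n) → ℝ}
    {K : NNReal} (hF : LipschitzWith K F) :
    Measurable (fun x : Fin n → ℝ => F (WithLp.toLp 2 x)) :=
  (hF.continuous.comp (PiLp.continuous_toLp 2 _)).measurable

/-- This is `K * r ≤ c * K² + r² / (4c)`, a completed square. It turns the Lipschitz condition into
the premise of an infimum-convolution inequality, with `c` matched to the cost. -/
theorem LipschitzWith.comp_toLp_sub_le {n : ℕ} {F : EuclideanSpace ℝ (Fin n) → ℝ}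
    {K : NNReal} (hF : LipschitzWith K F) (x y : Fin n → ℝ) {c : ℝ} (hc : 0 < c) :
    F (WithLp.toLp 2 x) - F (WithLp.toLp 2 y) ≤
      c * (K : ℝ) ^ 2 + ∑ i, (x i - y i) ^ 2 / (4 * c) := by
  have h1 := (le_abs_self _).trans (hF.dist_le_mul (WithLp.toLp 2 x) (WithLp.toLp 2 y))
  have h2 : ∑ i, (x i - y i) ^ 2 = dist (WithLp.toLp 2 x) (WithLp.toLp 2 y) ^ 2 := by
    rw [EuclideanSpace.dist_sq_eq]
    simp [Real.dist_eq, sq_abs]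
  rw [← Finset.sum_div, h2]
  set r := dist (WithLp.toLp 2 x) (WithLp.toLp 2 y)
  refine h1.trans ?_
  have h3 : c * (K : ℝ) ^ 2 + r ^ 2 / (4 * c) - K * r = (2 * c * K - r) ^ 2 / (4 * c) := by
    field_simp
    ring
  have h4 : 0 ≤ (2 * c * K - r) ^ 2 / (4 * c) := by positivity
  linarith

/-- Exponential concentration of convex Lipschitz functions of Rademacher variables. -/
theorem lintegral_exp_mul_lintegral_exp_neg_rademacher_le {n : ℕ}
    {F : EuclideanSpace ℝ (Fin n) → ℝ} {K : NNReal} (hF : LipschitzWith K F)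
    (hconv : ConvexOn ℝ Set.univ F) :
    (∫⁻ x, ENNReal.ofReal (Real.exp (F (WithLp.toLp 2 x)))
        ∂Measure.pi (fun _ : Fin n => rademacher)) *
      (∫⁻ x, ENNReal.ofReal (Real.exp (-F (WithLp.toLp 2 x)))
        ∂Measure.pi (fun _ : Fin n => rademacher)) ≤
      ENNReal.ofReal (Real.exp (4 * (K : ℝ) ^ 2)) := by
  have hcont : Continuous (fun x : Fin n → ℝ => F (WithLp.toLp 2 x)) :=
    hF.continuous.comp (PiLp.continuous_toLp 2 _)
  obtain ⟨C, hC⟩ := (isCompact_Icc (a := (-1 : Fin n → ℝ)) (b := 1)).bddBelow_image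
    hcont.continuousOn
  have h := cube_infConv n (fun x => F (WithLp.toLp 2 x)) C
    ((hconv.comp_linearMap (WithLp.linearEquiv 2 ℝ (Fin n → ℝ)).symm.toLinearMap).subset
      (Set.subset_univ _) (convex_Icc _ _))
    (fun y hy => hC ⟨y, hy, rfl⟩)
    (fun b => F (WithLp.toLp 2 (boolSign ∘ b)) - 4 * (K : ℝ) ^ 2)
    (fun b y _ => by
      have := hF.comp_toLp_sub_le (boolSign ∘ b) y (c := 4) (by norm_num)
      norm_num at this ⊢
      linarith)
  have hm := hF.measurable_comp_toLp
  have hm' : Measurable (fun x : Fin n → ℝ => -F (WithLp.toLp 2 x)) := hm.neg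
  rw [lintegral_pi_rademacher n hm.exp.ennreal_ofReal,
    lintegral_pi_rademacher n hm'.exp.ennreal_ofReal,
    ← ENNReal.ofReal_sum_of_nonneg (fun _ _ => (Real.exp_pos _).le),
    ← ENNReal.ofReal_sum_of_nonneg (fun _ _ => (Real.exp_pos _).le),
    show (2⁻¹ : ℝ≥0∞) ^ n = ENNReal.ofReal ((2⁻¹ : ℝ) ^ n) by
      rw [ENNReal.ofReal_pow (by norm_num), ENNReal.ofReal_inv_of_pos (by norm_num),
        ENNReal.ofReal_ofNat],
    ← ENNReal.ofReal_mul (by positivity), ← ENNReal.ofReal_mul (by positivity),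
    ← ENNReal.ofReal_mul (by positivity)]
  refine ENNReal.ofReal_le_ofReal ?_
  simp_rw [Real.exp_sub, ← Finset.sum_div] at h
  rw [div_mul_eq_mul_div, div_le_iff₀ (Real.exp_pos _)] at h
  calc _ = (4⁻¹ : ℝ) ^ n * ((∑ b : Fin n → Bool, Real.exp (F (WithLp.toLp 2 (boolSign ∘ b)))) *
        ∑ b : Fin n → Bool, Real.exp (-F (WithLp.toLp 2 (boolSign ∘ b)))) := by
        rw [show (4⁻¹ : ℝ) = 2⁻¹ * 2⁻¹ by norm_num, mul_pow]
        ring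
    _ ≤ (4⁻¹ : ℝ) ^ n * (4 ^ n * Real.exp (4 * (K : ℝ) ^ 2)) :=
        mul_le_mul_of_nonneg_left h (by positivity)
    _ = _ := by rw [← mul_assoc, ← mul_pow]; norm_num

/-! ### Brunn-Minkowski and Prékopa-Leindler on the line -/

/-- The Brunn-Minkowski inequality on the line for compact sets. -/
theorem IsCompact.volume_add_volume_le {K L C : Set ℝ} (hK : IsCompact K) (hL : IsCompact L)
    (hK0 : K.Nonempty) (hL0 : L.Nonempty) (h : ∀ x ∈ K, ∀ y ∈ L, x + y ∈ C) :
    volume K + volume L ≤ volume C := by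
  -- The translates `K + l` and `k + L` both lie in `C` and meet only at `k + l`, a null set.
  set k := sSup K
  set l := sInf L
  have hk : k ∈ K := hK.sSup_mem hK0
  have hl : l ∈ L := hL.sInf_mem hL0
  have h1 : volume K ≤ volume (C ∩ Set.Iic (k + l)) := by
    rw [← measure_preimage_add_right volume (-l) K]
    refine measure_mono fun x hx => ⟨?_, ?_⟩
    · simpa using h _ hx _ hl
    · have : x + -l ≤ k := le_csSup hK.bddAbove hx
      simp only [Set.mem_Iic]
      linarith
  have h2 : volume L ≤ volume (C \ Set.Iic (k + l)) := by
    have h3 : (fun x => -k + x) ⁻¹' L ⊆ (C \ Set.Iic (k + l)) ∪ {k + l} := by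
      intro x hx
      have h4 : x ∈ C := by simpa using h _ hk _ hx
      have h5 : l ≤ -k + x := csInf_le hL.bddBelow hx
      rcases eq_or_ne x (k + l) with h6 | h6
      · exact Or.inr h6
      · refine Or.inl ⟨h4, fun h7 => h6 (le_antisymm h7 (by linarith))⟩
    rw [← measure_preimage_add volume (-k) L]
    refine (measure_mono h3).trans ((measure_union_le _ _).trans ?_)
    simp
  rw [← measure_inter_add_sdiff C (measurableSet_Iic (a := k + l))]
  exact add_le_add h1 h2

/-- Inner regularity, with a point of `A` adjoined to each compact set: Brunn-Minkowski fails for an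
empty summand. -/
theorem MeasurableSet.volume_le_iSup_nonempty_isCompact {A : Set ℝ} (hA : MeasurableSet A)
    (hA0 : A.Nonempty) :
    volume A ≤ ⨆ K ∈ {K : Set ℝ | K ⊆ A ∧ IsCompact K ∧ K.Nonempty}, volume K := by
  obtain ⟨a, ha⟩ := hA0
  refine le_of_forall_lt fun r hr => ?_
  obtain ⟨K, hKA, hK, hrK⟩ := hA.exists_lt_isCompact hr
  refine (hrK.trans_le (measure_mono (Set.subset_insert a K))).trans_le
    (le_iSup₂ (f := fun (K : Set ℝ) (_ : K ∈ {K : Set ℝ | K ⊆ A ∧ IsCompact K ∧ K.Nonempty}) =>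
      volume K) (insert a K) ⟨Set.insert_subset ha hKA, hK.insert a, Set.insert_nonempty a K⟩)

/-- The Brunn-Minkowski inequality on the line. -/
theorem MeasurableSet.volume_add_volume_le {A B C : Set ℝ} (hA : MeasurableSet A)
    (hB : MeasurableSet B) (hA0 : A.Nonempty) (hB0 : B.Nonempty)
    (h : ∀ x ∈ A, ∀ y ∈ B, x + y ∈ C) : volume A + volume B ≤ volume C :=
  (add_le_add (hA.volume_le_iSup_nonempty_isCompact hA0)
    (hB.volume_le_iSup_nonempty_isCompact hB0)).trans <|
    ENNReal.biSup_add_biSup_le (s := {K | K ⊆ A ∧ IsCompact K ∧ K.Nonempty})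
      (t := {K | K ⊆ B ∧ IsCompact K ∧ K.Nonempty})
      ⟨{hA0.some}, Set.singleton_subset_iff.2 hA0.some_mem, isCompact_singleton,
        Set.singleton_nonempty _⟩
      ⟨{hB0.some}, Set.singleton_subset_iff.2 hB0.some_mem, isCompact_singleton,
        Set.singleton_nonempty _⟩
      fun _ hK _ hL => hK.2.1.volume_add_volume_le hL.2.1 hK.2.2 hL.2.2
        fun x hx y hy => h x (hK.1 hx) y (hL.1 hy)

theorem ENNReal.mul_le_sq_of_add_le_two_mul {p q r : ℝ≥0∞} (h : p + q ≤ 2 * r) :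
    p * q ≤ r ^ 2 := by
  rcases eq_or_ne r ⊤ with rfl | hr
  · simp
  have hpq : p + q ≠ ⊤ := ne_top_of_le_ne_top (ENNReal.mul_ne_top (by simp) hr) h
  rw [ENNReal.add_ne_top] at hpq
  lift p to NNReal using hpq.1
  lift q to NNReal using hpq.2
  lift r to NNReal using hr
  norm_cast at h ⊢
  have h' : (p : ℝ) + q ≤ 2 * r := by exact_mod_cast h
  have : (p : ℝ) * q ≤ r ^ 2 := by
    nlinarith [sq_nonneg ((p : ℝ) - q), p.2, q.2, r.2, pow_le_pow_left₀ (by positivity) h' 2]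
  exact_mod_cast this

/-- Layer-cake integration of Brunn-Minkowski for superlevel sets. Both suprema being one, the sets
at each level `t < 1` are nonempty, and both are empty for `t ≥ 1`. The factor 2 undoes the halving
in the midpoint. -/
theorem lintegral_add_lintegral_le_of_superlevel {f g w : ℝ → ℝ} (hf : Measurable f)
    (hg : Measurable g) (hw : Measurable w) (hf0 : 0 ≤ f) (hg0 : 0 ≤ g) (hw0 : 0 ≤ w)
    (hf1 : ∀ x, f x ≤ 1) (hg1 : ∀ x, g x ≤ 1) (hft : ∀ t < 1, ∃ x, t < f x)
    (hgt : ∀ t < 1, ∃ x, t < g x)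
    (h : ∀ x y t, 0 < t → t < f x → t < g y → t < w ((x + y) / 2)) :
    (∫⁻ x, ENNReal.ofReal (f x)) + (∫⁻ x, ENNReal.ofReal (g x)) ≤
      2 * ∫⁻ x, ENNReal.ofReal (w x) := by
  rw [lintegral_eq_lintegral_meas_lt volume (f := f) (.of_forall hf0) hf.aemeasurable,
    lintegral_eq_lintegral_meas_lt volume (f := g) (.of_forall hg0) hg.aemeasurable,
    lintegral_eq_lintegral_meas_lt volume (f := w) (.of_forall hw0) hw.aemeasurable,
    ← lintegral_const_mul' _ _ (by simp)]
  refine (le_lintegral_add _ _).trans (setLIntegral_mono' measurableSet_Ioi fun t ht => ?_)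
  rcases lt_or_ge t 1 with ht1 | ht1
  · have h1 := MeasurableSet.volume_add_volume_le (C := (fun z => 2⁻¹ * z) ⁻¹' {z | t < w z})
      (hf measurableSet_Ioi) (hg measurableSet_Ioi) (hft t ht1) (hgt t ht1)
      (fun x hx y hy => by
        have := h x y t ht hx hy
        simpa [div_eq_inv_mul] using this)
    rw [Real.volume_preimage_mul_left (by norm_num)] at h1
    simp only [inv_inv, abs_two, ENNReal.ofReal_ofNat] at h1
    exact h1
  · have h1 : {a | t < f a} = ∅ := Set.eq_empty_of_forall_notMem fun x hx =>
      absurd (hf1 x) (not_le.2 (ht1.trans_lt hx))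
    have h2 : {a | t < g a} = ∅ := Set.eq_empty_of_forall_notMem fun x hx =>
      absurd (hg1 x) (not_le.2 (ht1.trans_lt hx))
    simp [h1, h2]

/-- The Prékopa-Leindler inequality on the line (midpoint case, bounded functions). -/
theorem prekopa_leindler_midpoint {u v w : ℝ → ℝ} (hu : Measurable u) (hv : Measurable v)
    (hw : Measurable w) (hu0 : 0 ≤ u) (hv0 : 0 ≤ v) (hw0 : 0 ≤ w)
    (hub : BddAbove (Set.range u)) (hvb : BddAbove (Set.range v))
    (h : ∀ x y, u x * v y ≤ w ((x + y) / 2) ^ 2) :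
    (∫⁻ x, ENNReal.ofReal (u x)) * ∫⁻ x, ENNReal.ofReal (v x) ≤
      (∫⁻ x, ENNReal.ofReal (w x)) ^ 2 := by
  set a := ⨆ x, u x
  set b := ⨆ x, v x
  have hua : ∀ x, u x ≤ a := le_ciSup hub
  have hvb' : ∀ x, v x ≤ b := le_ciSup hvb
  have ha' : 0 ≤ a := (hu0 0).trans (hua 0)
  rcases ha'.eq_or_lt' with ha | ha
  · have : ∀ x, u x = 0 := fun x => le_antisymm (ha ▸ hua x) (hu0 x)
    simp [this]
  have hb' : 0 ≤ b := (hv0 0).trans (hvb' 0)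
  rcases hb'.eq_or_lt' with hb | hb
  · have : ∀ x, v x = 0 := fun x => le_antisymm (hb ▸ hvb' x) (hv0 x)
    simp [this]
  have hab : 0 < √(a * b) := Real.sqrt_pos.2 (mul_pos ha hb)
  -- Normalising `u` and `v` to supremum one, and `w` by the geometric mean of the two suprema,
  -- preserves the hypothesis; AM-GM then converts the additive bound into the product.
  have key := ENNReal.mul_le_sq_of_add_le_two_mul <|
    lintegral_add_lintegral_le_of_superlevel (f := fun x => u x / a) (g := fun x => v x / b)
      (w := fun x => w x / √(a * b)) (hu.div_const _) (hv.div_const _) (hw.div_const _)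
      (fun x => div_nonneg (hu0 x) ha.le) (fun x => div_nonneg (hv0 x) hb.le)
      (fun x => div_nonneg (hw0 x) hab.le)
      (fun x => (div_le_one ha).2 (hua x)) (fun x => (div_le_one hb).2 (hvb' x))
      (fun t ht => by
        obtain ⟨x, hx⟩ := exists_lt_of_lt_ciSup (show t * a < ⨆ x, u x from
          mul_lt_of_lt_one_left ha ht)
        exact ⟨x, (lt_div_iff₀ ha).2 hx⟩)
      (fun t ht => by
        obtain ⟨x, hx⟩ := exists_lt_of_lt_ciSup (show t * b < ⨆ x, v x from
          mul_lt_of_lt_one_left hb ht)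
        exact ⟨x, (lt_div_iff₀ hb).2 hx⟩)
      (fun x y t ht hx hy => by
        rw [lt_div_iff₀ ha] at hx
        rw [lt_div_iff₀ hb] at hy
        rw [lt_div_iff₀ hab]
        refine lt_of_pow_lt_pow_left₀ 2 (hw0 _) (lt_of_lt_of_le ?_ (h x y))
        rw [mul_pow, Real.sq_sqrt (mul_pos ha hb).le]
        calc t ^ 2 * (a * b) = (t * a) * (t * b) := by ring
          _ < u x * v y := mul_lt_mul'' hx hy (by positivity) (by positivity))
  have hscale : ∀ (f : ℝ → ℝ) {c : ℝ}, 0 < c → ∫⁻ x, ENNReal.ofReal (f x) =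
      ENNReal.ofReal c * ∫⁻ x, ENNReal.ofReal (f x / c) := by
    intro f c hc
    rw [← lintegral_const_mul' _ _ (by simp)]
    refine lintegral_congr fun x => ?_
    rw [← ENNReal.ofReal_mul hc.le, mul_div_cancel₀ _ hc.ne']
  rw [hscale u ha, hscale v hb, hscale w hab, mul_pow, ← ENNReal.ofReal_pow hab.le,
    Real.sq_sqrt (mul_pos ha hb).le, mul_mul_mul_comm, ← ENNReal.ofReal_mul ha.le]
  gcongr

/-! ### Gaussian infimum convolution and concentration -/

/-- The parallelogram identity in the exponent; it is why the Gaussian cost is `(x - y)² / 4`. -/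
theorem gaussianPDFReal_mul_mul_exp (x y : ℝ) :
    gaussianPDFReal 0 1 x * gaussianPDFReal 0 1 y * Real.exp ((x - y) ^ 2 / 4) =
      gaussianPDFReal 0 1 ((x + y) / 2) ^ 2 := by
  simp only [gaussianPDFReal, sub_zero, NNReal.coe_one, mul_one, mul_pow]
  rw [← Real.exp_nat_mul, mul_mul_mul_comm, ← Real.exp_add, mul_assoc, ← Real.exp_add, ← sq]
  congr 2
  push_cast
  ring

theorem lintegral_gaussianReal_ofReal {u : ℝ → ℝ} (hu : Measurable u) :
    ∫⁻ x, ENNReal.ofReal (u x) ∂gaussianReal 0 1 =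
      ∫⁻ x, ENNReal.ofReal (gaussianPDFReal 0 1 x * u x) := by
  rw [gaussianReal_of_var_ne_zero _ one_ne_zero,
    lintegral_withDensity_eq_lintegral_mul _ (measurable_gaussianPDF 0 1) hu.ennreal_ofReal]
  refine lintegral_congr fun x => ?_
  rw [Pi.mul_apply, gaussianPDF, ENNReal.ofReal_mul (gaussianPDFReal_nonneg _ _ _)]

theorem gaussianPDFReal_le_one (x : ℝ) : gaussianPDFReal 0 1 x ≤ 1 := by
  simp only [gaussianPDFReal, sub_zero, NNReal.coe_one, mul_one]
  refine mul_le_one₀ (inv_le_one_of_one_le₀ ?_) (Real.exp_pos _).le ?_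
  · rw [Real.one_le_sqrt]
    nlinarith [Real.pi_gt_three]
  · rw [Real.exp_le_one_iff]
    nlinarith [sq_nonneg x]

/-- Supplies the boundedness needed for Prékopa-Leindler: testing against one fixed point `y` bounds
the product by a squared density, hence by one. -/
theorem bddAbove_gaussianPDFReal_mul {u : ℝ → ℝ} {y b : ℝ} (hb : 0 < b)
    (h : ∀ x, u x * b ≤ Real.exp ((x - y) ^ 2 / 4)) :
    BddAbove (Set.range fun x => gaussianPDFReal 0 1 x * u x) := by
  have hy := gaussianPDFReal_pos 0 1 y one_ne_zero
  refine ⟨1 / (gaussianPDFReal 0 1 y * b), ?_⟩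
  rintro _ ⟨x, rfl⟩
  rw [le_div_iff₀ (by positivity)]
  calc _ = gaussianPDFReal 0 1 x * gaussianPDFReal 0 1 y * (u x * b) := by ring
    _ ≤ gaussianPDFReal 0 1 x * gaussianPDFReal 0 1 y * Real.exp ((x - y) ^ 2 / 4) :=
        mul_le_mul_of_nonneg_left (h x)
          (mul_nonneg (gaussianPDFReal_nonneg _ _ _) (gaussianPDFReal_nonneg _ _ _))
    _ = gaussianPDFReal 0 1 ((x + y) / 2) ^ 2 := gaussianPDFReal_mul_mul_exp x y
    _ ≤ 1 := pow_le_one₀ (gaussianPDFReal_nonneg _ _ _) (gaussianPDFReal_le_one _)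

/-- The infimum-convolution inequality for the standard Gaussian measure on the line. -/
theorem gaussian_infConv {u v : ℝ → ℝ≥0∞} (hu : Measurable u) (hv : Measurable v)
    (h : ∀ x y, u x * v y ≤ ENNReal.ofReal (Real.exp ((x - y) ^ 2 / 4))) :
    (∫⁻ x, u x ∂gaussianReal 0 1) * ∫⁻ x, v x ∂gaussianReal 0 1 ≤ 1 := by
  by_cases hu0 : ∀ x, u x = 0
  · simp [hu0]
  by_cases hv0 : ∀ x, v x = 0
  · simp [hv0]
  push Not at hu0 hv0
  obtain ⟨x₀, hx₀⟩ := hu0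
  obtain ⟨y₀, hy₀⟩ := hv0
  have huf : ∀ x, u x ≠ ⊤ := fun x hx => by
    have := h x y₀
    rw [hx, ENNReal.top_mul hy₀] at this
    exact ENNReal.ofReal_ne_top (top_le_iff.1 this)
  have hvf : ∀ y, v y ≠ ⊤ := fun y hy => by
    have := h x₀ y
    rw [hy, ENNReal.mul_top hx₀] at this
    exact ENNReal.ofReal_ne_top (top_le_iff.1 this)
  have hr : ∀ x y, (u x).toReal * (v y).toReal ≤ Real.exp ((x - y) ^ 2 / 4) := fun x y => by
    rw [← ENNReal.toReal_mul]
    exact ENNReal.toReal_le_of_le_ofReal (Real.exp_pos _).le (h x y)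
  have hpdf := measurable_gaussianPDFReal 0 1
  have key := prekopa_leindler_midpoint (hpdf.mul hu.ennreal_toReal) (hpdf.mul hv.ennreal_toReal)
    hpdf (fun x => mul_nonneg (gaussianPDFReal_nonneg _ _ _) ENNReal.toReal_nonneg)
    (fun x => mul_nonneg (gaussianPDFReal_nonneg _ _ _) ENNReal.toReal_nonneg)
    (fun x => gaussianPDFReal_nonneg _ _ _)
    (bddAbove_gaussianPDFReal_mul (ENNReal.toReal_pos hy₀ (hvf y₀)) (fun x => hr x y₀))
    (bddAbove_gaussianPDFReal_mul (y := x₀) (ENNReal.toReal_pos hx₀ (huf x₀)) (fun y => by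
      have := hr x₀ y
      rwa [mul_comm, ← neg_sub, neg_sq] at this))
    (fun x y => by
      rw [← gaussianPDFReal_mul_mul_exp]
      calc _ = gaussianPDFReal 0 1 x * gaussianPDFReal 0 1 y *
            ((u x).toReal * (v y).toReal) := by simp only [Pi.mul_apply]; ring
        _ ≤ _ := mul_le_mul_of_nonneg_left (hr x y)
          (mul_nonneg (gaussianPDFReal_nonneg _ _ _) (gaussianPDFReal_nonneg _ _ _)))
  simp only [Pi.mul_apply] at key
  rw [← lintegral_gaussianReal_ofReal hu.ennreal_toReal,
    ← lintegral_gaussianReal_ofReal hv.ennreal_toReal] at key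
  simp only [ENNReal.ofReal_toReal (huf _), ENNReal.ofReal_toReal (hvf _)] at key
  refine key.trans (le_of_eq ?_)
  have := lintegral_gaussianPDF_eq_one 0 (v := 1) one_ne_zero
  simp only [gaussianPDF] at this
  rw [this, one_pow]

/-- The infimum-convolution inequality for the standard Gaussian measure. -/
theorem gaussian_pi_infConv (n : ℕ) : ∀ {u v : (Fin n → ℝ) → ℝ≥0∞}, Measurable u →
    Measurable v →
    (∀ x y, u x * v y ≤ ENNReal.ofReal (Real.exp (∑ i, (x i - y i) ^ 2 / 4))) →
    (∫⁻ x, u x ∂Measure.pi fun _ : Fin n => gaussianReal 0 1) *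
      ∫⁻ x, v x ∂Measure.pi (fun _ : Fin n => gaussianReal 0 1) ≤ 1 := by
  induction n with
  | zero =>
    intro u v hu hv h
    rw [Measure.pi_of_empty _ default, lintegral_dirac' _ hu, lintegral_dirac' _ hv]
    simpa using h default default
  | succ n ih =>
    intro u v hu hv h
    have hu' := hu.comp measurable_fin_cons
    have hv' := hv.comp measurable_fin_cons
    rw [lintegral_pi_fin_succ _ hu, lintegral_pi_fin_succ _ hv]
    refine gaussian_infConv (Measurable.lintegral_prod_right' hu')
      (Measurable.lintegral_prod_right' hv') fun s t => ?_
    set e := ENNReal.ofReal (Real.exp ((s - t) ^ 2 / 4)) with he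
    have he0 : e ≠ 0 := (ENNReal.ofReal_pos.2 (Real.exp_pos _)).ne'
    have hef : e ≠ ⊤ := ENNReal.ofReal_ne_top
    have hus : Measurable fun x : Fin n → ℝ => u (Fin.cons s x) :=
      hu'.comp measurable_prodMk_left
    have hvt : Measurable fun x : Fin n → ℝ => v (Fin.cons t x) :=
      hv'.comp measurable_prodMk_left
    -- Dividing out the cost of the first coordinate leaves the hypothesis in dimension `n` for the
    -- two slices.
    have := ih (u := fun x => e⁻¹ * u (Fin.cons s x)) (hus.const_mul _) hvt fun x y => by
      have h1 := h (Fin.cons s x) (Fin.cons t y)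
      rw [Fin.sum_univ_succ, Real.exp_add, ENNReal.ofReal_mul (Real.exp_pos _).le] at h1
      simp only [Fin.cons_zero, Fin.cons_succ] at h1
      rw [mul_assoc, ENNReal.inv_mul_le_iff he0 hef]
      exact h1
    rw [lintegral_const_mul _ hus, mul_assoc, ENNReal.inv_mul_le_iff he0 hef, mul_one] at this
    exact this

/-- Exponential concentration of Lipschitz functions of standard Gaussian variables. -/
theorem lintegral_exp_mul_lintegral_exp_neg_gaussian_le {n : ℕ}
    {F : EuclideanSpace ℝ (Fin n) → ℝ} {K : NNReal} (hF : LipschitzWith K F) :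
    (∫⁻ x, ENNReal.ofReal (Real.exp (F (WithLp.toLp 2 x)))
        ∂Measure.pi (fun _ : Fin n => gaussianReal 0 1)) *
      (∫⁻ x, ENNReal.ofReal (Real.exp (-F (WithLp.toLp 2 x)))
        ∂Measure.pi (fun _ : Fin n => gaussianReal 0 1)) ≤
      ENNReal.ofReal (Real.exp ((K : ℝ) ^ 2)) := by
  have hm := hF.measurable_comp_toLp
  have hm' : Measurable (fun x : Fin n → ℝ => -F (WithLp.toLp 2 x)) := hm.neg
  set e := ENNReal.ofReal (Real.exp ((K : ℝ) ^ 2)) with he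
  have he0 : e ≠ 0 := (ENNReal.ofReal_pos.2 (Real.exp_pos _)).ne'
  have hef : e ≠ ⊤ := ENNReal.ofReal_ne_top
  have := gaussian_pi_infConv n (hm.exp.ennreal_ofReal.const_mul e⁻¹) hm'.exp.ennreal_ofReal
    fun x y => by
      rw [mul_assoc, ENNReal.inv_mul_le_iff he0 hef, ← ENNReal.ofReal_mul (Real.exp_pos _).le,
        he, ← ENNReal.ofReal_mul (Real.exp_pos _).le, ← Real.exp_add, ← Real.exp_add]
      refine ENNReal.ofReal_le_ofReal (Real.exp_le_exp.2 ?_)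
      have := hF.comp_toLp_sub_le x y (c := 1) one_pos
      rw [one_mul, mul_one] at this
      rwa [← sub_eq_add_neg]
  rw [lintegral_const_mul _ hm.exp.ennreal_ofReal, mul_assoc, ENNReal.inv_mul_le_iff he0 hef,
    mul_one] at this
  exact this

/-! ### Extended expectations and support functions -/

theorem expect_mono {Ω : Type*} [MeasurableSpace Ω] (P : Measure Ω) {X Y : Ω → EReal}
    (h : ∀ ω, X ω ≤ Y ω) : expect P X ≤ expect P Y := by
  refine EReal.sub_le_sub ?_ ?_
  · exact EReal.coe_ennreal_le_coe_ennreal_iff.2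
      (lintegral_mono fun ω => EReal.toENNReal_le_toENNReal (h ω))
  · exact EReal.coe_ennreal_le_coe_ennreal_iff.2
      (lintegral_mono fun ω => EReal.toENNReal_le_toENNReal (EReal.neg_le_neg_iff.2 (h ω)))

theorem expect_bot {Ω : Type*} [MeasurableSpace Ω] (P : Measure Ω) [IsProbabilityMeasure P] :
    expect P (fun _ => (⊥ : EReal)) = ⊥ := by
  simp [expect]

/-- The support function of a set, as a real number. -/
noncomputable def supportFun {E : Type*} [NormedAddCommGroup E] [InnerProductSpace ℝ E]
    (A : Set E) (x : E) : ℝ :=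
  ⨆ z : A, inner ℝ x (z : E)

section SupportFun

variable {E : Type*} [NormedAddCommGroup E] [InnerProductSpace ℝ E] {A : Set E} {L : ℝ}

theorem bddAbove_range_inner (hL : ∀ z ∈ A, ‖z‖ ≤ L) (x : E) :
    BddAbove (Set.range fun z : A => inner ℝ x (z : E)) := by
  refine ⟨‖x‖ * L, ?_⟩
  rintro _ ⟨z, rfl⟩
  exact (real_inner_le_norm _ _).trans (mul_le_mul_of_nonneg_left (hL z z.2) (norm_nonneg _))

theorem inner_le_supportFun (hL : ∀ z ∈ A, ‖z‖ ≤ L) (x : E) {z : E} (hz : z ∈ A) :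
    inner ℝ x z ≤ supportFun A x :=
  le_ciSup (bddAbove_range_inner hL x) (⟨z, hz⟩ : A)

theorem supportFun_le (hA : A.Nonempty) {x : E} {b : ℝ} (h : ∀ z ∈ A, inner ℝ x z ≤ b) :
    supportFun A x ≤ b :=
  have := hA.to_subtype
  ciSup_le fun z => h z z.2

theorem convexOn_supportFun (hL : ∀ z ∈ A, ‖z‖ ≤ L) (hA : A.Nonempty) :
    ConvexOn ℝ Set.univ (supportFun A) := by
  refine ⟨convex_univ, fun x _ y _ a b ha hb _ => supportFun_le hA fun z hz => ?_⟩
  rw [inner_add_left, real_inner_smul_left, real_inner_smul_left]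
  exact add_le_add (mul_le_mul_of_nonneg_left (inner_le_supportFun hL x hz) ha)
    (mul_le_mul_of_nonneg_left (inner_le_supportFun hL y hz) hb)

theorem lipschitzWith_supportFun (hL : ∀ z ∈ A, ‖z‖ ≤ L) (hA : A.Nonempty) :
    LipschitzWith L.toNNReal (supportFun A) := by
  refine LipschitzWith.of_le_add_mul _ fun x y => supportFun_le hA fun z hz => ?_
  have hL0 : 0 ≤ L := (norm_nonneg z).trans (hL z hz)
  have h1 : inner ℝ (x - y) z ≤ L * dist x y := by
    rw [dist_eq_norm, mul_comm]
    exact (real_inner_le_norm _ _).trans (mul_le_mul_of_nonneg_left (hL z hz) (norm_nonneg _))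
  rw [inner_sub_left] at h1
  rw [Real.coe_toNNReal _ hL0]
  linarith [inner_le_supportFun hL y hz]

end SupportFun

theorem supInner_eq_coe_supportFun {n : ℕ} {A : Set (EuclideanSpace ℝ (Fin n))} {L : ℝ}
    (hL : ∀ z ∈ A, ‖z‖ ≤ L) (hA : A.Nonempty) (x : Fin n → ℝ) :
    supInner A x = (supportFun A (WithLp.toLp 2 x) : ℝ) := by
  refine le_antisymm (iSup₂_le fun z hz => EReal.coe_le_coe_iff.2 (inner_le_supportFun hL _ hz))
    ?_
  have hle : ∀ z ∈ A, ((inner ℝ (WithLp.toLp 2 x) z : ℝ) : EReal) ≤ supInner A x := fun z hz =>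
    le_iSup₂ (f := fun z (_ : z ∈ A) => ((inner ℝ (WithLp.toLp 2 x) z : ℝ) : EReal)) z hz
  induction hs : supInner A x with
  | bot =>
    obtain ⟨z, hz⟩ := hA
    have := hle z hz
    rw [hs] at this
    exact absurd (le_bot_iff.1 this) (EReal.coe_ne_bot _)
  | top => exact le_top
  | coe s =>
    refine EReal.coe_le_coe_iff.2 (supportFun_le hA fun z hz => ?_)
    have := hle z hz
    rw [hs] at this
    exact EReal.coe_le_coe_iff.1 this

/-! ### Exponential moments and the maximal inequality -/

/-- Jensen's inequality for the exponential function. -/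
theorem ofReal_exp_integral_le {Ω : Type*} [MeasurableSpace Ω] {P : Measure Ω}
    [IsProbabilityMeasure P] {Z : Ω → ℝ} (hZ : Integrable Z P) :
    ENNReal.ofReal (Real.exp (∫ ω, Z ω ∂P)) ≤ ∫⁻ ω, ENNReal.ofReal (Real.exp (Z ω)) ∂P := by
  set c := ∫ ω, Z ω ∂P with hc
  -- The tangent to `exp` at the mean is integrable and lies below `exp`, so `exp ∘ Z` may have
  -- infinite integral.
  have hint : Integrable (fun ω => Real.exp c * (Z ω - c + 1)) P :=
    ((hZ.sub (integrable_const c)).add (integrable_const 1)).const_mul _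
  have h1 : ∫ ω, Real.exp c * (Z ω - c + 1) ∂P = Real.exp c := by
    have hsub : Integrable (fun ω => Z ω - c) P := hZ.sub (integrable_const c)
    rw [integral_const_mul, integral_add hsub (integrable_const 1),
      integral_sub hZ (integrable_const c)]
    simp [← hc]
  calc ENNReal.ofReal (Real.exp c) = ENNReal.ofReal (∫ ω, Real.exp c * (Z ω - c + 1) ∂P) := by
        rw [h1]
    _ ≤ ∫⁻ ω, ENNReal.ofReal (Real.exp c * (Z ω - c + 1)) ∂P := by
        rw [integral_eq_lintegral_pos_part_sub_lintegral_neg_part hint]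
        exact (ENNReal.ofReal_le_ofReal (sub_le_self _ ENNReal.toReal_nonneg)).trans
          ENNReal.ofReal_toReal_le
    _ ≤ ∫⁻ ω, ENNReal.ofReal (Real.exp (Z ω)) ∂P := by
        refine lintegral_mono fun ω => ENNReal.ofReal_le_ofReal ?_
        calc _ ≤ Real.exp c * Real.exp (Z ω - c) :=
              mul_le_mul_of_nonneg_left (Real.add_one_le_exp _) (Real.exp_pos _).le
          _ = _ := by rw [← Real.exp_add, add_sub_cancel]

/-- The bound `l / t + t * k²` is minimised at `t = √l / k`; for `k = 0`, large `t` forces `d ≤ 0`.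
-/
theorem le_two_mul_sqrt_of_forall_mul_le {d k l : ℝ} (hk : 0 ≤ k) (hl : 0 < l)
    (h : ∀ t > 0, t * d ≤ l + (t * k) ^ 2) : d ≤ 2 * k * √l := by
  rcases hk.eq_or_lt with rfl | hk
  · by_contra! hd
    simp only [mul_zero, zero_mul] at hd
    have := h (2 * l / d) (by positivity)
    rw [div_mul_cancel₀ _ hd.ne'] at this
    linarith
  · have hs := Real.sqrt_pos.2 hl
    have := h (√l / k) (by positivity)
    rw [div_mul_cancel₀ _ hk.ne', Real.sq_sqrt hl.le, div_mul_eq_mul_div, div_le_iff₀ hk] at this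
    have h2 : √l * d ≤ √l * (2 * k * √l) := by
      calc _ ≤ _ := this
        _ = 2 * k * (√l * √l) := by rw [Real.mul_self_sqrt hl.le]; ring
        _ = _ := by ring
    exact le_of_mul_le_mul_left h2 hs

/-- The maximal inequality for finitely many random variables with Gaussian exponential
concentration. -/
theorem integral_le_add_two_mul_sqrt_log {Ω ι : Type*} [MeasurableSpace Ω] {P : Measure Ω}
    [IsProbabilityMeasure P] [Fintype ι] {M : ℕ} (hM : 1 < M) (hcard : Fintype.card ι ≤ M)
    {X : ι → Ω → ℝ} {Y : Ω → ℝ} {a k : ℝ} (hk : 0 ≤ k)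
    (hX : ∀ m, Integrable (X m) P) (hY : Integrable Y P) (hXY : ∀ ω, ∃ m, Y ω ≤ X m ω)
    (ha : ∀ m, ∫ ω, X m ω ∂P ≤ a)
    (hconc : ∀ t > 0, ∀ m, (∫⁻ ω, ENNReal.ofReal (Real.exp (t * X m ω)) ∂P) *
      (∫⁻ ω, ENNReal.ofReal (Real.exp (-(t * X m ω))) ∂P) ≤
        ENNReal.ofReal (Real.exp ((t * k) ^ 2))) :
    ∫ ω, Y ω ∂P ≤ a + 2 * k * √(Real.log M) := by
  have hM' : (1 : ℝ) < M := by exact_mod_cast hM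
  rw [← sub_le_iff_le_add']
  refine le_two_mul_sqrt_of_forall_mul_le hk (Real.log_pos hM') fun t ht => ?_
  have hZ : ∫ ω, t * (Y ω - a) ∂P = t * (∫ ω, Y ω ∂P - a) := by
    rw [integral_const_mul, integral_sub hY (integrable_const a)]
    simp
  have hmeas : ∀ m, AEMeasurable (fun ω => ENNReal.ofReal (Real.exp (t * (X m ω - a)))) P :=
    fun m => (((hX m).aemeasurable.sub_const a).const_mul t).exp.ennreal_ofReal
  have hterm : ∀ m, ∫⁻ ω, ENNReal.ofReal (Real.exp (t * (X m ω - a))) ∂P ≤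
      ENNReal.ofReal (Real.exp ((t * k) ^ 2)) := by
    intro m
    refine le_trans ?_ (hconc t ht m)
    have h1 : ∫⁻ ω, ENNReal.ofReal (Real.exp (t * (X m ω - a))) ∂P =
        (∫⁻ ω, ENNReal.ofReal (Real.exp (t * X m ω)) ∂P) *
          ENNReal.ofReal (Real.exp (-(t * a))) := by
      rw [← lintegral_mul_const' _ _ ENNReal.ofReal_ne_top]
      refine lintegral_congr fun ω => ?_
      rw [← ENNReal.ofReal_mul (Real.exp_pos _).le, ← Real.exp_add]
      ring_nf
    rw [h1]
    gcongr
    -- Jensen for `-t * X m`, with mean at least `-t * a`, replaces the second concentration factor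
    -- by `e^(-t a)`.
    refine le_trans (ENNReal.ofReal_le_ofReal (Real.exp_le_exp.2 ?_))
      (ofReal_exp_integral_le ((hX m).const_mul t).neg)
    rw [integral_neg, integral_const_mul]
    exact neg_le_neg (mul_le_mul_of_nonneg_left (ha m) ht.le)
  have hmain : ENNReal.ofReal (Real.exp (t * (∫ ω, Y ω ∂P - a))) ≤
      ENNReal.ofReal (M * Real.exp ((t * k) ^ 2)) :=
    calc _ ≤ ∫⁻ ω, ENNReal.ofReal (Real.exp (t * (Y ω - a))) ∂P := by
          rw [← hZ]
          exact ofReal_exp_integral_le ((hY.sub (integrable_const a)).const_mul t)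
      _ ≤ ∫⁻ ω, ∑ m, ENNReal.ofReal (Real.exp (t * (X m ω - a))) ∂P := by
          refine lintegral_mono fun ω => ?_
          obtain ⟨m, hm⟩ := hXY ω
          refine le_trans (ENNReal.ofReal_le_ofReal (Real.exp_le_exp.2
            (mul_le_mul_of_nonneg_left (sub_le_sub_right hm a) ht.le)))
            (Finset.single_le_sum (f := fun m => ENNReal.ofReal (Real.exp (t * (X m ω - a))))
              (fun _ _ => zero_le) (Finset.mem_univ m))
      _ = ∑ m, ∫⁻ ω, ENNReal.ofReal (Real.exp (t * (X m ω - a))) ∂P :=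
          lintegral_finsetSum' _ fun m _ => hmeas m
      _ ≤ ∑ _m : ι, ENNReal.ofReal (Real.exp ((t * k) ^ 2)) :=
          Finset.sum_le_sum fun m _ => hterm m
      _ = (Fintype.card ι : ℝ≥0∞) * ENNReal.ofReal (Real.exp ((t * k) ^ 2)) := by
          rw [Finset.sum_const, nsmul_eq_mul, Finset.card_univ]
      _ ≤ (M : ℝ≥0∞) * ENNReal.ofReal (Real.exp ((t * k) ^ 2)) := by
          gcongr
      _ = _ := by rw [ENNReal.ofReal_mul (by positivity), ENNReal.ofReal_natCast]
  have hreal := (ENNReal.ofReal_le_ofReal_iff (by positivity)).1 hmain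
  rwa [← Real.exp_log (show (0 : ℝ) < M by linarith), ← Real.exp_add, Real.exp_le_exp] at hreal

/-! ### Assembly over the union -/

theorem integrable_lipschitzWith_comp_toLp {Ω : Type*} [MeasurableSpace Ω] {P : Measure Ω}
    [IsProbabilityMeasure P] {n : ℕ} {ε : Fin n → Ω → ℝ} (hε : ∀ i, Integrable (ε i) P)
    {F : EuclideanSpace ℝ (Fin n) → ℝ} {K : NNReal} (hF : LipschitzWith K F) :
    Integrable (fun ω => F (WithLp.toLp 2 fun i => ε i ω)) P := by
  have hm : AEMeasurable (fun ω => F (WithLp.toLp 2 fun i => ε i ω)) P :=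
    hF.measurable_comp_toLp.comp_aemeasurable (aemeasurable_pi_lambda _ fun i =>
      (hε i).aemeasurable)
  refine Integrable.mono' (g := fun ω => |F 0| + K * ∑ i, |ε i ω|) ?_ hm.aestronglyMeasurable
    (.of_forall fun ω => ?_)
  · exact (integrable_const _).add
      ((integrable_finsetSum _ fun i _ => (hε i).abs).const_mul _)
  · have h1 := hF.dist_le_mul (WithLp.toLp 2 fun i => ε i ω) 0
    have h2 : ‖(WithLp.toLp 2 fun i => ε i ω : EuclideanSpace ℝ (Fin n))‖ ≤ ∑ i, |ε i ω| := by
      rw [EuclideanSpace.norm_eq]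
      refine Real.sqrt_le_iff.2 ⟨Finset.sum_nonneg fun i _ => abs_nonneg _, ?_⟩
      exact Finset.sum_sq_le_sq_sum_of_nonneg fun i _ => abs_nonneg _
    rw [dist_zero_right, Real.dist_eq] at h1
    have h3 := mul_le_mul_of_nonneg_left h2 K.coe_nonneg
    have h4 := abs_sub_abs_le_abs_sub (F (WithLp.toLp 2 fun i => ε i ω)) (F 0)
    rw [Real.norm_eq_abs]
    linarith

/-- The expected supremum over a finite union, for coordinates whose convex Lipschitz functions
concentrate. -/
theorem expect_supInner_iUnion_le {Ω : Type*} [MeasurableSpace Ω] (P : Measure Ω)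
    [IsProbabilityMeasure P] {n M : ℕ} (hM : 1 < M) (A : Fin M → Set (EuclideanSpace ℝ (Fin n)))
    {ε : Fin n → Ω → ℝ} (hε : ∀ i, Integrable (ε i) P) {c : ℝ} (hc : 0 < c)
    (hconc : ∀ (F : EuclideanSpace ℝ (Fin n) → ℝ) (K : NNReal), LipschitzWith K F →
      ConvexOn ℝ Set.univ F →
      (∫⁻ ω, ENNReal.ofReal (Real.exp (F (WithLp.toLp 2 fun i => ε i ω))) ∂P) *
        (∫⁻ ω, ENNReal.ofReal (Real.exp (-F (WithLp.toLp 2 fun i => ε i ω))) ∂P) ≤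
          ENNReal.ofReal (Real.exp (c ^ 2 * (K : ℝ) ^ 2))) :
    expect P (fun ω => supInner (⋃ m, A m) (fun i => ε i ω)) ≤
      (⨆ m, expect P (fun ω => supInner (A m) (fun i => ε i ω))) +
        ((2 * c : ℝ) : EReal) * supNorm (⋃ m, A m) * ((√(Real.log M) : ℝ) : EReal) := by
  have hM' : (1 : ℝ) < M := by exact_mod_cast hM
  have hlog : 0 < √(Real.log M) := Real.sqrt_pos.2 (Real.log_pos hM')
  rcases (⋃ m, A m).eq_empty_or_nonempty with hempty | hne
  · have : ∀ x : Fin n → ℝ, supInner (⋃ m, A m) x = ⊥ := fun x => by simp [hempty, supInner]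
    simp only [this, expect_bot, bot_le]
  obtain ⟨z₀, hz₀⟩ := hne
  obtain ⟨m₀, hm₀⟩ := Set.mem_iUnion.1 hz₀
  have hnorm : ∀ z ∈ ⋃ m, A m, ((‖z‖ : ℝ) : EReal) ≤ supNorm (⋃ m, A m) := fun z hz =>
    le_iSup₂ (f := fun z (_ : z ∈ ⋃ m, A m) => ((‖z‖ : ℝ) : EReal)) z hz
  induction hs : supNorm (⋃ m, A m) with
  | bot =>
    have := hnorm z₀ hz₀
    rw [hs] at this
    exact absurd (le_bot_iff.1 this) (EReal.coe_ne_bot _)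
  | top =>
    -- With infinite radius the right side is `⊤` unless the maximum is `⊥`; the integrable linear
    -- functional of one point of the union excludes that.
    have hlow : (⨆ m, expect P (fun ω => supInner (A m) (fun i => ε i ω))) ≠ ⊥ := by
      have hint : Integrable (fun ω => inner ℝ (WithLp.toLp 2 fun i => ε i ω) z₀) P := by
        have := integrable_lipschitzWith_comp_toLp hε (lipschitzWith_supportFun (A := {z₀})
          (L := ‖z₀‖) (by simp) (Set.singleton_nonempty z₀))
        simpa [supportFun] using this
      have h1 : expect P (fun ω => ((inner ℝ (WithLp.toLp 2 fun i => ε i ω) z₀ : ℝ) : EReal)) ≤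
          expect P (fun ω => supInner (A m₀) (fun i => ε i ω)) :=
        expect_mono P fun ω => le_iSup₂ (f := fun z (_ : z ∈ A m₀) =>
          ((inner ℝ (WithLp.toLp 2 fun i => ε i ω) z : ℝ) : EReal)) z₀ hm₀
      rw [expect_coe P _ hint] at h1
      exact ne_bot_of_le_ne_bot (EReal.coe_ne_bot _) (h1.trans
        (le_iSup (fun m => expect P (fun ω => supInner (A m) (fun i => ε i ω))) m₀))
    rw [EReal.coe_mul_top_of_pos (by positivity), EReal.top_mul_coe_of_pos hlog,
      EReal.add_top_of_ne_bot hlow]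
    exact le_top
  | coe L =>
    have hL : ∀ z ∈ ⋃ m, A m, ‖z‖ ≤ L := fun z hz => by
      have := hnorm z hz
      rw [hs] at this
      exact EReal.coe_le_coe_iff.1 this
    have hL0 : 0 ≤ L := (norm_nonneg _).trans (hL z₀ hz₀)
    have hLm : ∀ m, ∀ z ∈ A m, ‖z‖ ≤ L := fun m z hz => hL z (Set.mem_iUnion.2 ⟨m, hz⟩)
    -- Empty pieces are dropped: `supportFun` takes the default value 0 on them, whereas `supInner`
    -- is `⊥`.
    let ι := {m : Fin M // (A m).Nonempty}
    have : Nonempty ι := ⟨⟨m₀, z₀, hm₀⟩⟩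
    have : Fintype ι := Fintype.ofFinite ι
    set X : ι → Ω → ℝ := fun m ω => supportFun (A m) (WithLp.toLp 2 fun i => ε i ω) with hXdef
    set Y : Ω → ℝ := fun ω => supportFun (⋃ m, A m) (WithLp.toLp 2 fun i => ε i ω) with hYdef
    have hX : ∀ m, Integrable (X m) P := fun m =>
      integrable_lipschitzWith_comp_toLp hε (lipschitzWith_supportFun (hLm m) m.2)
    have hY : Integrable Y P :=
      integrable_lipschitzWith_comp_toLp hε (lipschitzWith_supportFun hL ⟨z₀, hz₀⟩)
    obtain ⟨m₁, hm₁⟩ := Finite.exists_max fun m : ι => ∫ ω, X m ω ∂P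
    have key := integral_le_add_two_mul_sqrt_log (P := P) (X := X) (Y := Y)
      (a := ∫ ω, X m₁ ω ∂P) (k := c * L) hM
      ((Fintype.card_le_of_injective _ Subtype.val_injective).trans_eq (Fintype.card_fin M))
      (by positivity) hX hY
      (fun ω => by
        obtain ⟨m, hm⟩ := Finite.exists_max fun m : ι => X m ω
        refine ⟨m, supportFun_le ⟨z₀, hz₀⟩ fun z hz => ?_⟩
        obtain ⟨j, hj⟩ := Set.mem_iUnion.1 hz
        exact (inner_le_supportFun (hLm j) _ hj).trans (hm ⟨j, z, hj⟩))
      hm₁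
      (fun t ht m => by
        have hlip : LipschitzWith (t * L).toNNReal (fun x => t * supportFun (A m) x) := by
          refine LipschitzWith.of_le_add_mul _ fun x y => ?_
          have := (lipschitzWith_supportFun (hLm m) m.2).le_add_mul x y
          rw [Real.coe_toNNReal _ hL0] at this
          rw [Real.coe_toNNReal _ (by positivity)]
          nlinarith
        have := hconc _ _ hlip ((convexOn_supportFun (hLm m) m.2).smul ht.le)
        rw [Real.coe_toNNReal _ (by positivity), ← mul_pow,
          show c * (t * L) = t * (c * L) by ring] at this
        exact this)
    have hYe : expect P (fun ω => supInner (⋃ m, A m) (fun i => ε i ω)) =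
        ((∫ ω, Y ω ∂P : ℝ) : EReal) := by
      rw [← expect_coe P Y hY]
      simp only [supInner_eq_coe_supportFun hL ⟨z₀, hz₀⟩, hYdef]
    have hXe : expect P (fun ω => supInner (A m₁) (fun i => ε i ω)) =
        ((∫ ω, X m₁ ω ∂P : ℝ) : EReal) := by
      rw [← expect_coe P (X m₁) (hX m₁)]
      simp only [supInner_eq_coe_supportFun (hLm m₁) m₁.2, hXdef]
    rw [hYe]
    refine le_trans (EReal.coe_le_coe_iff.2 key) ?_
    rw [← mul_assoc, EReal.coe_add, ← hXe, EReal.coe_mul, EReal.coe_mul (2 * c)]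
    exact add_le_add_left
      (le_iSup (fun m => expect P (fun ω => supInner (A m) (fun i => ε i ω))) _) _

theorem ProbabilityTheory.HasLaw.integrable_of_integrable_id {Ω : Type*} [MeasurableSpace Ω]
    {P : Measure Ω} {μ : Measure ℝ} {X : Ω → ℝ} (hX : HasLaw X μ P) (hμ : Integrable id μ) :
    Integrable X P := by
  rw [← hX.map_eq] at hμ
  exact hμ.comp_aemeasurable hX.aemeasurable

theorem lemma2 {Ω : Type*} [MeasurableSpace Ω] (P : Measure Ω) [IsProbabilityMeasure P]
    {n M : ℕ} (hM : 4 ≤ M) (A : Fin M → Set (EuclideanSpace ℝ (Fin n)))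
    (ε : Fin n → Ω → ℝ) (hindep : iIndepFun ε P) :
    ((∀ i, HasLaw (ε i) rademacher P) →
      expect P (fun ω => supInner (⋃ m, A m) (fun i => ε i ω)) ≤
        (⨆ m, expect P (fun ω => supInner (A m) (fun i => ε i ω))) +
          4 * supNorm (⋃ m, A m) * ((Real.sqrt (Real.log M) : ℝ) : EReal)) ∧
    ((∀ i, HasLaw (ε i) (gaussianReal 0 1) P) →
      expect P (fun ω => supInner (⋃ m, A m) (fun i => ε i ω)) ≤
        (⨆ m, expect P (fun ω => supInner (A m) (fun i => ε i ω))) +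
          2 * supNorm (⋃ m, A m) * ((Real.sqrt (Real.log M) : ℝ) : EReal)) := by
  -- Independence makes the joint law a product measure, to which the concentration inequalities
  -- apply.
  have hlint : ∀ {μ : Measure ℝ} [IsProbabilityMeasure μ], (∀ i, HasLaw (ε i) μ P) →
      ∀ {f : EuclideanSpace ℝ (Fin n) → ℝ}, Measurable (fun x => f (WithLp.toLp 2 x)) →
      ∫⁻ ω, ENNReal.ofReal (Real.exp (f (WithLp.toLp 2 fun i => ε i ω))) ∂P =
        ∫⁻ x, ENNReal.ofReal (Real.exp (f (WithLp.toLp 2 x))) ∂Measure.pi (fun _ => μ) :=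
    fun h _ hf => (iIndepFun.hasLaw_pi h hindep).lintegral_comp
      hf.exp.ennreal_ofReal.aemeasurable
  refine ⟨fun h => ?_, fun h => ?_⟩
  · have := expect_supInner_iUnion_le P (by omega : 1 < M) A
      (fun i => (h i).integrable_of_integrable_id integrable_id_rademacher) (c := 2) two_pos
      fun F K hF hconv => by
        have hm := hF.measurable_comp_toLp
        rw [hlint h hm, hlint (f := fun x => -F x) h hm.neg]
        convert lintegral_exp_mul_lintegral_exp_neg_rademacher_le hF hconv using 4
        norm_num
    rwa [show ((2 * 2 : ℝ) : EReal) = 4 by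
      norm_num
      exact EReal.coe_natCast (n := 4)] at this
  · have := expect_supInner_iUnion_le P (by omega : 1 < M) A
      (fun i => (h i).integrable_of_integrable_id ((memLp_id_gaussianReal 1).integrable le_rfl))
      (c := 1) one_pos fun F K hF _ => by
        have hm := hF.measurable_comp_toLp
        rw [hlint h hm, hlint (f := fun x => -F x) h hm.neg]
        convert lintegral_exp_mul_lintegral_exp_neg_gaussian_le hF using 3
        norm_num
    rwa [show ((2 * 1 : ℝ) : EReal) = 2 by
      norm_num
      exact EReal.coe_natCast (n := 2)] at this
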